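/- For every $n\ge 1$ let $\boldsymbol d_n=(d_{n,1},\dots,d_{n,n})$ be a sequence of non-negative integers, and let $D_n$ be the degree of a uniformly random vertex, i.e. $\Pr(D_n=k)=|\{i\in[n]: d_{n,i}=k\}|/n$. Suppose that there is a probability distribution $D$ on $\{0,1,2,\dots\}$ such that (i) for every $n$ there is a simple graph on $[n]$ in which each vertex $i$ has degree $d_{n,i}$; (ii) $D_n\to D$ in distribution; (iii) $\mathbb E[D^2]<\infty$, $\mathbb E[D_n]\to\mathbb E[D]$ and $\mathbb E[D_n^2]\to\mathbb E[D^2]$; (iv) whenever $\Pr(D=k)=0$, no $\boldsymbol d_n$ has an entry equal to $k$. Let $\nu=\mathbb E[D(D-1)]/\mathbb E[D]$ (with $\nu=0$ if $\mathbb E[D]=0$). The configuration model $\mathbb{CM}_n(\boldsymbol d_n)$ is the random multigraph on $[n]$ obtained by attaching $d_{n,i}$ half-edges to each vertex $i$ and choosing a uniformly random perfect matching of all the half-edges, each matched pair becoming an edge between the vertices to which its two half-edges are attached. A vertex with a loop counts as a cycle of length $1$, and two vertices with two parallel edges between them count as a cycle of length $2$. If $\nu<1$, then $$\lim_{n\to\infty}\Pr\bigl(\text{no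 connected component of }\mathbb{CM}_n(\boldsymbol d_n)\text{ contains more than one cycle}\bigr)=1.$$ -/

import Mathlib

open MeasureTheory ProbabilityTheory Filter Topology
open scoped BoundedContinuousFunction

noncomputable section

namespace ConfigModel

/-! ### Connected components and cycles of multigraphs -/

/-- A multigraph is connected if it has a vertex and any two of its vertices are joined by a
walk. -/
def IsConnected {α β : Type*} (G : Graph α β) : Prop :=
  G.vertexSet.Nonempty ∧
    ∀ u ∈ G.vertexSet, ∀ v ∈ G.vertexSet, Relation.ReflTransGen G.Adj u v

/-- `H` is a connected component of `G`: a maximal connected sub-multigraph. -/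
def IsComponent {α β : Type*} (H G : Graph α β) : Prop :=
  Maximal (fun K : Graph α β => K ≤ G ∧ IsConnected K) H

/-- `C` is a `(k + 1)`-cycle: its distinct vertices `v 0, …, v k` and its distinct edges
`e 0, …, e k` can be arranged cyclically, with `e i` joining `v i` to `v (i + 1)`
(addition in `Fin (k + 1)` is modulo `k + 1`). A `1`-cycle is a vertex with a loop, a `2`-cycle
is two vertices with two parallel edges. -/
def IsCycleOfLength {α β : Type*} (k : ℕ) (C : Graph α β) : Prop :=
  ∃ (v : Fin (k + 1) → α) (e : Fin (k + 1) → β),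
    Function.Injective v ∧ Function.Injective e ∧
    C.vertexSet = Set.range v ∧ C.edgeSet = Set.range e ∧
    ∀ i, C.IsLink (e i) (v i) (v (i + 1))

/-- `C` is a cycle, of some length at least `1`. -/
def IsCycle {α β : Type*} (C : Graph α β) : Prop :=
  ∃ k, IsCycleOfLength k C

/-- Some connected component of `G` contains more than one cycle, that is, two different
sub-multigraphs which are cycles. -/
def HasComponentWithTwoCycles {α β : Type*} (G : Graph α β) : Prop :=
  ∃ H, IsComponent H G ∧
    ∃ C₁ C₂, C₁ ≤ H ∧ C₂ ≤ H ∧ IsCycle C₁ ∧ IsCycle C₂ ∧ C₁ ≠ C₂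

/-! ### The configuration model -/

/-- The half-edges of a degree sequence `d`: `d v` of them are incident to the vertex `v`, and
the half-edge `h` is incident to the vertex `h.1`. -/
abbrev HalfEdge {n : ℕ} (d : Fin n → ℕ) : Type := Σ v : Fin n, Fin (d v)

/-- `M` is a perfect matching of the half-edges: a set of pairs of different half-edges such
that every half-edge lies in exactly one of the pairs. -/
def IsPerfectMatching {n : ℕ} {d : Fin n → ℕ} (M : Finset (Sym2 (HalfEdge d))) : Prop :=
  (∀ p ∈ M, ¬ p.IsDiag) ∧ ∀ h : HalfEdge d, ∃! p, p ∈ M ∧ h ∈ p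

/-- The configurations: the perfect matchings of the half-edges of `d`. -/
def Configuration {n : ℕ} (d : Fin n → ℕ) : Type :=
  {M : Finset (Sym2 (HalfEdge d)) // IsPerfectMatching M}

instance {n : ℕ} (d : Fin n → ℕ) : MeasurableSpace (Configuration d) := ⊤

/-- The law of the configuration model: a uniformly random configuration. -/
def configurationLaw {n : ℕ} (d : Fin n → ℕ) : Measure (Configuration d) :=
  uniformOn Set.univ

/-- The underlying multigraph of a configuration. Its vertices are those of `d`, its edges are
the matched pairs of half-edges, and a pair joins the vertices that its two half-edges are
incident to. -/
def underlyingMultigraph {n : ℕ} {d : Fin n → ℕ} (M : Configuration d) :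
    Graph (Fin n) (Sym2 (HalfEdge d)) where
  vertexSet := Set.univ
  IsLink p u v := p ∈ M.1 ∧ p.map Sigma.fst = s(u, v)
  isLink_symm := fun _ _ => ⟨fun _ _ h => ⟨h.1, h.2.trans Sym2.eq_swap⟩⟩
  eq_or_eq_of_isLink_of_isLink := by
    rintro p x y v w ⟨_, h₁⟩ ⟨_, h₂⟩
    rw [h₁, Sym2.eq_iff] at h₂
    rcases h₂ with h | h
    · exact Or.inl h.1
    · exact Or.inr h.1
  left_mem_of_isLink := fun _ _ _ _ => Set.mem_univ _

/-! ### Degree sequences and degree distributions -/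

/-- A degree sequence is feasible if it is the degree sequence of some simple graph. -/
def IsFeasible {n : ℕ} (d : Fin n → ℕ) : Prop :=
  ∃ G : SimpleGraph (Fin n), ∀ v, (G.neighborSet v).ncard = d v

/-- The degree distribution `D_n` of a degree sequence: the law of the degree of a uniformly
random vertex. -/
def degreeDistribution {n : ℕ} (d : Fin n → ℕ) : Measure ℕ :=
  (uniformOn (Set.univ : Set (Fin n))).map d

/-- The regularity assumption on a sequence of degree sequences `d`, of lengths `1, 2, 3, …`
(the empty sequence `d 0` plays no role), with limiting degree distribution `D`. -/
structure IsRegular (d : (n : ℕ) → Fin n → ℕ) (D : Measure ℕ) : Prop where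
  feasible : ∀ n, IsFeasible (d n)
  /-- `D_n` converges to `D` in distribution. -/
  tendsto_dist : ∀ f : ℕ →ᵇ ℝ,
    Tendsto (fun n => ∫ k, f k ∂(degreeDistribution (d n))) atTop (𝓝 (∫ k, f k ∂D))
  integrable_sq : Integrable (fun k : ℕ => (k : ℝ) ^ 2) D
  tendsto_mean :
    Tendsto (fun n => ∫ k, (k : ℝ) ∂(degreeDistribution (d n))) atTop (𝓝 (∫ k, (k : ℝ) ∂D))
  tendsto_sq :
    Tendsto (fun n => ∫ k, (k : ℝ) ^ 2 ∂(degreeDistribution (d n))) atTop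
      (𝓝 (∫ k, (k : ℝ) ^ 2 ∂D))
  /-- A degree that has probability zero in the limit does not occur at all. -/
  degree_ne : ∀ k, D {k} = 0 → ∀ n, ∀ v : Fin n, d n v ≠ k

/-- The parameter `ν = E[D(D-1)] / E[D]` (equal to `0` if `D = 0` almost surely). -/
def nu (D : Measure ℕ) : ℝ :=
  (∫ k, (k : ℝ) * ((k : ℝ) - 1) ∂D) / ∫ k, (k : ℝ) ∂D

end ConfigModel

end

/-! A component with two different cycles contains a vertex set `W` spanning more than `W.card`
edges (`exists_internalHalfEdges_of_edge`). Pruning vertices of degree at most one and walking out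
of a vertex of degree at least three yields a closed trail (`exists_isClosedTrail`): a path on `k`
distinct vertices both of whose ends are matched back into the path, hence `k + 1` matched pairs on
only `k` vertices.

Closed trails are excluded by a first moment bound. Let `N` be the number of half-edges, `S = ∑ d(d
- 1)` and `Δ` the maximal degree. There are at most `S ^ k` ways to choose the half-edges through
which the path enters and leaves its vertices, and `(k * Δ) ^ 2` ways to choose the partners of its
ends. Each prescribed pair costs a factor `1 / q`, for any `q` below the number of half-edges still
available (`card_pairingsContaining_mul_le`). Since `S / N → ν < 1`, taking `q = (1 - ε) * N` gives
a ratio `r < 1` and a total of order `(Δ ^ 2 / N) * ∑ k ^ 2 * r ^ k`. This tends to zero because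
convergence of the second moments forces `Δ ^ 2 = o(n)`. Paths with at least `L = ⌊ε * N / 2⌋`
vertices are cut to length `L`, and even without closure they contribute only `q * r ^ L`. -/

namespace ConfigModel

/-! ### Pairings of half-edges and trails -/

section Trail

variable {V H : Type*}

/-- A pairing of the elements of `H`: an involution without fixed points. -/
structure IsPairing (σ : H → H) : Prop where
  apply_apply : ∀ h, σ (σ h) = h
  apply_ne : ∀ h, σ h ≠ h

/-- A list of pairs `(a, b)` of different half-edges, the half-edges of a pair being incident to
the same vertex, different pairs to different vertices, and the second half-edge of each pair being
matched with the first half-edge of the next one. -/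
structure IsTrail (π : H → V) (σ : H → H) (l : List (H × H)) : Prop where
  ne : ∀ p ∈ l, p.1 ≠ p.2
  vertex_eq : ∀ p ∈ l, π p.1 = π p.2
  nodup : (l.map fun p => π p.1).Nodup
  chain : l.IsChain fun p q => σ p.2 = q.1

/-- The reversal of a trail. -/
def reverseTrail (l : List (H × H)) : List (H × H) := (l.map Prod.swap).reverse

theorem mem_reverseTrail {l : List (H × H)} {p : H × H} :
    p ∈ reverseTrail l ↔ p.swap ∈ l := by
  simp only [reverseTrail, List.mem_reverse, List.mem_map]
  constructor
  · rintro ⟨q, hq, rfl⟩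
    simpa using hq
  · intro h
    exact ⟨_, h, Prod.swap_swap p⟩

theorem IsTrail.reverse {π : H → V} {σ : H → H} (hσ : IsPairing σ) {l : List (H × H)}
    (h : IsTrail π σ l) : IsTrail π σ (reverseTrail l) where
  ne p hp := (h.ne _ (mem_reverseTrail.1 hp)).symm
  vertex_eq p hp := (h.vertex_eq _ (mem_reverseTrail.1 hp)).symm
  nodup := by
    have : (reverseTrail l).map (fun p => π p.1) = (l.map fun p => π p.1).reverse := by
      rw [reverseTrail, List.map_reverse, List.map_map]
      congr 1
      exact List.map_congr_left fun p hp => (h.vertex_eq p hp).symm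
    rw [this, List.nodup_reverse]
    exact h.nodup
  chain := by
    rw [reverseTrail, List.isChain_reverse, List.isChain_map]
    refine h.chain.imp fun p q hpq => ?_
    simp only [Prod.snd_swap, Prod.fst_swap, ← hpq, hσ.apply_apply]

theorem IsTrail.take {π : H → V} {σ : H → H} {l : List (H × H)} (h : IsTrail π σ l) (n : ℕ) :
    IsTrail π σ (l.take n) where
  ne p hp := h.ne p (List.mem_of_mem_take hp)
  vertex_eq p hp := h.vertex_eq p (List.mem_of_mem_take hp)
  nodup := by
    rw [List.map_take]
    exact h.nodup.sublist (List.take_sublist _ _)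
  chain := h.chain.take n

/-- A trail within `W` can be extended at its front until it returns to itself. -/
theorem IsTrail.exists_extension [DecidableEq V] {π : H → V} {σ : H → H} (hσ : IsPairing σ)
    {W : Finset V} (hW : ∀ h, π h ∈ W → ∃ h', h' ≠ h ∧ π h' = π h ∧ π (σ h') ∈ W)
    {a b : H} {l : List (H × H)} (hl : IsTrail π σ ((a, b) :: l))
    (hlW : ∀ p ∈ (a, b) :: l, π p.1 ∈ W) (ha : π (σ a) ∈ W) :
    ∃ t a' b' l', t ++ (a, b) :: l = (a', b') :: l' ∧ IsTrail π σ ((a', b') :: l') ∧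
      (∀ p ∈ (a', b') :: l', π p.1 ∈ W) ∧ ∃ q ∈ (a', b') :: l', π q.1 = π (σ a') := by
  induction hm : W.card - l.length using Nat.strong_induction_on generalizing a b l with
  | _ m ih =>
    by_cases hq : ∃ q ∈ (a, b) :: l, π q.1 = π (σ a)
    · exact ⟨[], a, b, l, rfl, hl, hlW, hq⟩
    · push Not at hq
      obtain ⟨h', hne, hπ, hin⟩ := hW _ ha
      -- The vertices of a trail are distinct and lie in `W`, so the measure `W.card - l.length`
      -- really drops with each new pair and the walk must return.
      have hcard : l.length + 1 ≤ W.card := by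
        have := (List.toFinset_card_of_nodup hl.nodup)
        simp only [List.length_map, List.length_cons] at this
        rw [← this]
        refine Finset.card_le_card fun v hv => ?_
        simp only [List.mem_toFinset, List.mem_map] at hv
        obtain ⟨p, hp, rfl⟩ := hv
        exact hlW p hp
      have hl' : IsTrail π σ ((h', σ a) :: (a, b) :: l) := by
        refine ⟨?_, ?_, ?_, ?_⟩
        · rw [List.forall_mem_cons]; exact ⟨hne, hl.ne⟩
        · rw [List.forall_mem_cons]; exact ⟨hπ, hl.vertex_eq⟩
        · rw [List.map_cons, List.nodup_cons]
          refine ⟨fun hc => ?_, hl.nodup⟩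
          obtain ⟨p, hp, hpe⟩ := List.mem_map.1 hc
          exact hq p hp (hpe.trans hπ)
        · rw [List.isChain_cons_cons]; exact ⟨hσ.apply_apply a, hl.chain⟩
      obtain ⟨t, a', b', l', h1, h2⟩ := ih (W.card - (l.length + 1)) (by omega) hl'
        (by rw [List.forall_mem_cons]; exact ⟨by rw [hπ]; exact ha, hlW⟩) hin rfl
      exact ⟨t ++ [(h', σ a)], a', b', l', by rw [← h1]; simp, h2⟩

/-- A nonempty trail both of whose ends are matched with half-edges at vertices of the trail, but
not with each other. -/
def IsClosedTrail (π : H → V) (σ : H → H) (l : List (H × H)) : Prop :=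
  IsTrail π σ l ∧ ∃ hl : l ≠ [],
    (∃ q ∈ l, π q.1 = π (σ (l.head hl).1)) ∧ (∃ q ∈ l, π q.1 = π (σ (l.getLast hl).2)) ∧
      σ (l.head hl).1 ≠ (l.getLast hl).2

/-- Walk out of the vertex through `x` until the walk hits itself, then leave through another
half-edge and walk on until this end hits the trail too. The third half-edge is a spare, needed when
the first walk came back exactly through `y`. -/
theorem exists_isClosedTrail_of_degree [DecidableEq V] {π : H → V} {σ : H → H}
    (hσ : IsPairing σ) {W : Finset V}
    (hW : ∀ h, π h ∈ W → ∃ h', h' ≠ h ∧ π h' = π h ∧ π (σ h') ∈ W) {x y z : H}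
    (hx : π x ∈ W) (hy : π y = π x) (hz : π z = π x) (hxy : y ≠ x) (hxz : z ≠ x) (hyz : y ≠ z)
    (hxW : π (σ x) ∈ W) (hyW : π (σ y) ∈ W) (hzW : π (σ z) ∈ W) :
    ∃ l, IsClosedTrail π σ l := by
  obtain ⟨t, a, b, l, hl, htr, hlW, q, hq, hqa⟩ := IsTrail.exists_extension hσ hW
    (a := x) (b := y) (l := [])
    ⟨by simpa using hxy.symm, by simpa using hy.symm, by simp, by simp⟩ (by simpa using hx) hxW
  rw [← hl] at htr hlW hq
  -- At most one of `y` and `z` is the partner of `a`; the other one serves as the second exit.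
  obtain ⟨y', hy'x, hy'π, hy'W, hy'a⟩ : ∃ y', y' ≠ x ∧ π y' = π x ∧ π (σ y') ∈ W ∧ y' ≠ σ a := by
    by_cases h : y = σ a
    · exact ⟨z, hxz, hz, hzW, fun h' => hyz (h.trans h'.symm)⟩
    · exact ⟨y, hxy, hy, hyW, h⟩
  have htr' : IsTrail π σ (t ++ [(x, y')]) := by
    refine ⟨fun p hp => ?_, fun p hp => ?_, ?_, ?_⟩
    · rcases List.mem_append.1 hp with hp | hp
      · exact htr.ne p (List.mem_append_left _ hp)
      · rw [List.mem_singleton.1 hp]; exact hy'x.symm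
    · rcases List.mem_append.1 hp with hp | hp
      · exact htr.vertex_eq p (List.mem_append_left _ hp)
      · rw [List.mem_singleton.1 hp]; exact hy'π.symm
    · simpa using htr.nodup
    · have := htr.chain
      rw [List.isChain_append] at this ⊢
      simpa using this
  have hrev : reverseTrail (t ++ [(x, y')]) = (y', x) :: reverseTrail t := by
    simp [reverseTrail]
  have hmap : (t ++ [(x, y)]).map (fun p => π p.1) = (t ++ [(x, y')]).map fun p => π p.1 := by
    simp
  have hvert : ∀ v, (∃ p ∈ t ++ [(x, y)], π p.1 = v) →
      ∃ p ∈ (y', x) :: reverseTrail t, π p.1 = v := by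
    rintro v ⟨p, hp, rfl⟩
    have h1 : π p.1 ∈ (t ++ [(x, y')]).map fun p => π p.1 := by
      rw [← hmap]; exact List.mem_map_of_mem hp
    obtain ⟨r, hr, hrp⟩ := List.mem_map.1 h1
    refine ⟨r.swap, ?_, ?_⟩
    · rw [← hrev, mem_reverseTrail, Prod.swap_swap]; exact hr
    · rw [← hrp]; exact (htr'.vertex_eq r hr).symm
  have hlast : ∀ h, (((y', x) :: reverseTrail t).getLast h).2 = a := by
    intro h
    cases t with
    | nil =>
      have : x = a := by simpa using congrArg (fun l => l.head?.map Prod.fst) hl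
      simp [reverseTrail, this]
    | cons p t =>
      have : p = (a, b) := by simpa using congrArg (fun l => l.head?) hl
      simp [reverseTrail, this]
  have hrt := htr'.reverse hσ
  rw [hrev] at hrt
  obtain ⟨t₂, a', b', l₂, hl₂, htr₂, hlW₂, q₂, hq₂, hqa₂⟩ := IsTrail.exists_extension hσ hW hrt
    (by
      intro p hp
      rw [← hrev, mem_reverseTrail] at hp
      have h1 := htr'.vertex_eq _ hp
      simp only [Prod.fst_swap, Prod.snd_swap] at h1
      rw [← h1]
      have h2 : π p.2 ∈ (t ++ [(x, y')]).map fun p => π p.1 :=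
        List.mem_map_of_mem (f := fun p : H × H => π p.1) hp
      rw [← hmap] at h2
      obtain ⟨r, hr, hrp⟩ := List.mem_map.1 h2
      rw [← hrp]
      exact hlW r hr) hy'W
  have hlast₂ : ∀ h, (((a', b') :: l₂).getLast h).2 = a := by
    intro h
    rw [← hlast (by simp)]
    congr 1
    simp only [← hl₂]
    exact List.getLast_append_of_ne_nil _ (by simp)
  obtain ⟨q₁, hq₁, hqa₁⟩ := hvert _ ⟨q, hq, hqa⟩
  refine ⟨(a', b') :: l₂, htr₂, by simp, ⟨q₂, hq₂, hqa₂⟩, ⟨q₁, ?_, ?_⟩, ?_⟩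
  · rw [← hl₂]; exact List.mem_append_right _ hq₁
  · rw [hlast₂]; exact hqa₁
  · rw [hlast₂]
    -- If the two ends were matched with each other, then `σ a = a'`. Without a second extension `a'
    -- = y'`, against the choice of `y'`. Otherwise `a'` sits at a vertex new to the trail, whereas
    -- `σ a` sits at an old one.
    intro hc
    change σ a' = a at hc
    cases t₂ with
    | nil =>
      have : y' = a' := by simpa using congrArg (fun l => l.head?.map Prod.fst) hl₂
      subst this
      exact hy'a (by rw [← hc, hσ.apply_apply])
    | cons p t₂ =>
      have : p = (a', b') := by simpa using congrArg (fun l => l.head?) hl₂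
      subst this
      have hnd := htr₂.nodup
      rw [← hl₂, List.cons_append, List.map_cons, List.nodup_cons] at hnd
      apply hnd.1
      rw [List.map_append]
      refine List.mem_append_right _ (List.mem_map.2 ⟨q₁, hq₁, ?_⟩)
      rw [hqa₁, ← hc, hσ.apply_apply]

/-- The number of half-edges within a set `W` of vertices, that is, twice the number of edges. -/
def internalHalfEdges [Fintype H] [DecidableEq V] (π : H → V) (σ : H → H) (W : Finset V) :
    Finset H := {h | π h ∈ W ∧ π (σ h) ∈ W}

/-- Removing a vertex of internal degree at most one destroys at most two internal half-edges, so
the strict inequality survives. Once all internal degrees are at least two, averaging provides a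
vertex of degree at least three. -/
theorem exists_isClosedTrail [Fintype H] [DecidableEq V] {π : H → V} {σ : H → H}
    (hσ : IsPairing σ) {W : Finset V} (hW : 2 * W.card < (internalHalfEdges π σ W).card) :
    ∃ l, IsClosedTrail π σ l := by
  classical
  induction hm : W.card using Nat.strong_induction_on generalizing W with
  | _ m ih =>
    by_cases hdeg : ∃ v ∈ W, ({h ∈ internalHalfEdges π σ W | π h = v} : Finset H).card ≤ 1
    · obtain ⟨v, hv, hd⟩ := hdeg
      have hlt : (W.erase v).card < m := by rw [← hm]; exact Finset.card_erase_lt_of_mem hv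
      refine ih _ hlt ?_ rfl
      set A : Finset H := {h ∈ internalHalfEdges π σ W | π h = v} with hA
      have hsub : internalHalfEdges π σ W ⊆
          internalHalfEdges π σ (W.erase v) ∪ (A ∪ A.image σ) := by
        intro h hh
        simp only [internalHalfEdges, hA, Finset.mem_union, Finset.mem_filter, Finset.mem_univ,
          true_and, Finset.mem_erase, Finset.mem_image] at hh ⊢
        by_cases h1 : π h = v
        · exact Or.inr (Or.inl ⟨hh, h1⟩)
        · by_cases h2 : π (σ h) = v
          · exact Or.inr (Or.inr ⟨σ h, ⟨⟨hh.2, by rw [hσ.apply_apply]; exact hh.1⟩, h2⟩,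
              hσ.apply_apply h⟩)
          · exact Or.inl ⟨⟨h1, hh.1⟩, h2, hh.2⟩
      have h1 := Finset.card_le_card hsub
      have h2 := Finset.card_union_le (internalHalfEdges π σ (W.erase v)) (A ∪ A.image σ)
      have h3 := Finset.card_union_le A (A.image σ)
      have h4 : (A.image σ).card ≤ A.card := Finset.card_image_le
      have h5 := Finset.card_erase_add_one hv
      omega
    · push Not at hdeg
      have hsum : (internalHalfEdges π σ W).card =
          ∑ v ∈ W, ({h ∈ internalHalfEdges π σ W | π h = v} : Finset H).card :=
        Finset.card_eq_sum_card_fiberwise fun h hh => by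
          have := (Finset.mem_filter.1 hh).2.1
          exact this
      obtain ⟨v, hv, hv3⟩ :
          ∃ v ∈ W, 2 < ({h ∈ internalHalfEdges π σ W | π h = v} : Finset H).card := by
        by_contra! hc
        have := Finset.sum_le_card_nsmul W _ 2 hc
        rw [smul_eq_mul] at this
        omega
      obtain ⟨x, y, z, hx, hy, hz, hxy, hxz, hyz⟩ := Finset.two_lt_card_iff.1 hv3
      simp only [internalHalfEdges, Finset.mem_filter, Finset.mem_univ, true_and] at hx hy hz
      refine exists_isClosedTrail_of_degree hσ (W := W) (fun h hh => ?_) hx.1.1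
        (hy.2.trans hx.2.symm) (hz.2.trans hx.2.symm) hxy.symm hxz.symm hyz hx.1.2 hy.1.2 hz.1.2
      obtain ⟨h', hh', hne⟩ := Finset.exists_mem_ne (hdeg _ hh) h
      simp only [internalHalfEdges, Finset.mem_filter, Finset.mem_univ, true_and] at hh'
      exact ⟨h', hne, hh'.2, hh'.1.2⟩

end Trail

/-! ### Counting the pairings that contain given pairs -/

section Count

variable {V H : Type*}

open Classical in
/-- The pairings of `H`. -/
noncomputable def pairings (H : Type*) [Fintype H] : Finset (H → H) := {σ | IsPairing σ}

theorem mem_pairings [Fintype H] {σ : H → H} : σ ∈ pairings H ↔ IsPairing σ := by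
  simp [pairings]

/-- The entries of a list of pairs. -/
def halves (l : List (H × H)) : List H := l.flatMap fun p => [p.1, p.2]

theorem halves_cons (p : H × H) (l : List (H × H)) :
    halves (p :: l) = p.1 :: p.2 :: halves l := by simp [halves]

theorem halves_append (l l' : List (H × H)) : halves (l ++ l') = halves l ++ halves l' := by
  simp [halves]

theorem length_halves (l : List (H × H)) : (halves l).length = 2 * l.length := by
  induction l with
  | nil => rfl
  | cons p l ih => rw [halves_cons]; simp [ih]; ring

theorem mem_halves {l : List (H × H)} {h : H} : h ∈ halves l ↔ ∃ p ∈ l, h = p.1 ∨ h = p.2 := by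
  simp [halves]

open Classical in
/-- The pairings of `H` that contain all the pairs in `l`. -/
noncomputable def pairingsContaining [Fintype H] (l : List (H × H)) : Finset (H → H) :=
  {σ ∈ pairings H | ∀ p ∈ l, σ p.1 = p.2}

theorem mem_pairingsContaining [Fintype H] {l : List (H × H)} {σ : H → H} :
    σ ∈ pairingsContaining l ↔ IsPairing σ ∧ ∀ p ∈ l, σ p.1 = p.2 := by
  simp [pairingsContaining, pairings]

/-- Conjugation with a transposition moves a prescribed pair. -/
theorem card_pairingsContaining_cons_le [Fintype H] {a b z : H} {l : List (H × H)}
    (hl : (halves ((a, b) :: l)).Nodup) (hza : z ≠ a) (hzl : z ∉ halves l) :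
    (pairingsContaining ((a, b) :: l)).card ≤ (pairingsContaining ((a, z) :: l)).card := by
  classical
  rw [halves_cons] at hl
  simp only [List.nodup_cons, List.mem_cons, not_or] at hl
  obtain ⟨⟨hab, hal⟩, hbl, -⟩ := hl
  have hfix : ∀ x, x ≠ b → x ≠ z → Equiv.swap b z x = x := fun x h1 h2 =>
    Equiv.swap_apply_of_ne_of_ne h1 h2
  refine Finset.card_le_card_of_injOn (fun σ x => Equiv.swap b z (σ (Equiv.swap b z x))) ?_ ?_
  · intro σ hσ
    obtain ⟨hσ, hσl⟩ := mem_pairingsContaining.1 hσ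
    rw [List.forall_mem_cons] at hσl
    refine mem_pairingsContaining.2 ⟨⟨fun x => ?_, fun x hx => ?_⟩, ?_⟩
    · simp [hσ.apply_apply]
    · exact hσ.apply_ne _ (Equiv.swap_apply_eq_iff.1 hx)
    · rw [List.forall_mem_cons]
      refine ⟨?_, fun p hp => ?_⟩
      · have h := hσl.1
        simp only at h ⊢
        rw [hfix a hab hza.symm, h, Equiv.swap_apply_left]
      · have h1 : p.1 ∈ halves l := mem_halves.2 ⟨p, hp, Or.inl rfl⟩
        have h2 : p.2 ∈ halves l := mem_halves.2 ⟨p, hp, Or.inr rfl⟩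
        simp only
        rw [hfix p.1 (fun h => hbl (h ▸ h1)) (fun h => hzl (h ▸ h1)), hσl.2 p hp,
          hfix p.2 (fun h => hbl (h ▸ h2)) (fun h => hzl (h ▸ h2))]
  · intro σ _ τ _ h
    funext x
    have := congrFun h (Equiv.swap b z x)
    simpa using this

/-- Given the other pairs, the possible partners `z` of `a` define disjoint families of pairings,
each at least as large as the one for `b` by the transposition argument. At least `q` values of `z`
are available, so each prescribed pair costs a factor `1 / q`. -/
theorem card_pairingsContaining_mul_le [Fintype H] {q : ℝ} (hq : 0 ≤ q) {l : List (H × H)}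
    (hl : (halves l).Nodup) (hlq : q + 2 * l.length ≤ Fintype.card H + 1) :
    ((pairingsContaining l).card : ℝ) * q ^ l.length ≤ (pairings H).card := by
  classical
  induction l with
  | nil =>
    simp only [List.length_nil, pow_zero, mul_one, Nat.cast_le]
    exact Finset.card_le_card (Finset.filter_subset _ _)
  | cons p l ih =>
    obtain ⟨a, b⟩ := p
    have hl' := hl
    rw [halves_cons] at hl'
    simp only [List.nodup_cons, List.mem_cons, not_or] at hl'
    have hlen : (((a, b) :: l).length : ℝ) = l.length + 1 := by simp
    rw [hlen] at hlq
    specialize ih hl'.2.2 (by linarith)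
    -- The excluded half-edges are `a` and the `2 * l.length` already prescribed; this is the origin
    -- of the `+ 1` in `hlq`.
    set Z : Finset H := (insert a (halves l).toFinset)ᶜ with hZ
    have hZcard : q ≤ (Z.card : ℝ) := by
      have h1 : (insert a (halves l).toFinset).card ≤ 2 * l.length + 1 := by
        refine (Finset.card_insert_le _ _).trans ?_
        have := (halves l).toFinset_card_le
        rw [length_halves] at this
        omega
      have h2 : Z.card + (insert a (halves l).toFinset).card = Fintype.card H := by
        rw [hZ]; exact Finset.card_compl_add_card _
      have h3 : (Fintype.card H : ℝ) ≤ Z.card + (2 * l.length + 1) := by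
        rw [← h2]; push_cast; gcongr; exact_mod_cast h1
      linarith
    have hsum : Z.card * (pairingsContaining ((a, b) :: l)).card ≤
        (pairingsContaining l).card := by
      calc Z.card * (pairingsContaining ((a, b) :: l)).card
          = ∑ z ∈ Z, (pairingsContaining ((a, b) :: l)).card := by simp
        _ ≤ ∑ z ∈ Z, (pairingsContaining ((a, z) :: l)).card := by
            refine Finset.sum_le_sum fun z hz => ?_
            simp only [hZ, Finset.mem_compl, Finset.mem_insert, List.mem_toFinset, not_or] at hz
            exact card_pairingsContaining_cons_le hl hz.1 hz.2
        _ = (Z.biUnion fun z => pairingsContaining ((a, z) :: l)).card := by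
            refine (Finset.card_biUnion fun z _ z' _ hzz => ?_).symm
            refine Finset.disjoint_left.2 fun σ h1 h2 => ?_
            rw [mem_pairingsContaining, List.forall_mem_cons] at h1 h2
            exact hzz (h1.2.1.symm.trans h2.2.1)
        _ ≤ _ := by
            refine Finset.card_le_card fun σ hσ => ?_
            obtain ⟨z, -, hz⟩ := Finset.mem_biUnion.1 hσ
            rw [mem_pairingsContaining, List.forall_mem_cons] at hz
            exact mem_pairingsContaining.2 ⟨hz.1, hz.2.2⟩
    have hsum' : (Z.card : ℝ) * (pairingsContaining ((a, b) :: l)).card ≤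
        (pairingsContaining l).card := by exact_mod_cast hsum
    calc ((pairingsContaining ((a, b) :: l)).card : ℝ) * q ^ ((a, b) :: l).length
        = q * (pairingsContaining ((a, b) :: l)).card * q ^ l.length := by
          rw [List.length_cons]; ring
      _ ≤ Z.card * (pairingsContaining ((a, b) :: l)).card * q ^ l.length := by gcongr
      _ ≤ (pairingsContaining l).card * q ^ l.length := by gcongr
      _ ≤ _ := ih

/-! ### The pairs of half-edges matched along a trail -/

/-- The pairs of half-edges matched with each other along a trail. -/
def links : List (H × H) → List (H × H)
  | [] => []
  | [_] => []
  | p :: q :: l => (p.2, q.1) :: links (q :: l)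

theorem length_links (l : List (H × H)) : (links l).length = l.length - 1 := by
  induction l with
  | nil => rfl
  | cons p l ih =>
    cases l with
    | nil => rfl
    | cons q l => simp only [links, List.length_cons] at ih ⊢; omega

theorem forall_mem_links {σ : H → H} {l : List (H × H)}
    (hl : l.IsChain fun p q => σ p.2 = q.1) : ∀ p ∈ links l, σ p.1 = p.2 := by
  induction l with
  | nil => simp [links]
  | cons p l ih =>
    cases l with
    | nil => simp [links]
    | cons q l =>
      rw [List.isChain_cons_cons] at hl
      rw [links, List.forall_mem_cons]
      exact ⟨hl.1, ih hl.2⟩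

/-- The links regroup the same sequence of half-edges with a shift by one, leaving the two extreme
half-edges unpaired. -/
theorem halves_links {l : List (H × H)} (hl : l ≠ []) :
    halves l = (l.head hl).1 :: halves (links l) ++ [(l.getLast hl).2] := by
  induction l with
  | nil => exact absurd rfl hl
  | cons p l ih =>
    cases l with
    | nil => simp [halves, links]
    | cons q l =>
      rw [halves_cons, ih (by simp), links, halves_cons]
      simp

theorem IsTrail.nodup_halves {π : H → V} {σ : H → H} {l : List (H × H)} (h : IsTrail π σ l) :
    (halves l).Nodup := by
  induction l with
  | nil => simp [halves]
  | cons p l ih =>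
    have hl : IsTrail π σ l := ⟨fun p hp => h.ne p (List.mem_cons_of_mem _ hp),
      fun p hp => h.vertex_eq p (List.mem_cons_of_mem _ hp), (List.nodup_cons.1 h.nodup).2,
      h.chain.tail⟩
    have hp := h.vertex_eq p List.mem_cons_self
    have hnot : ∀ x, π x = π p.1 → x ∉ halves l := by
      intro x hx hxl
      obtain ⟨r, hr, hxr⟩ := mem_halves.1 hxl
      apply (List.nodup_cons.1 h.nodup).1
      refine List.mem_map.2 ⟨r, hr, ?_⟩
      rcases hxr with rfl | rfl
      · exact hx
      · rw [hl.vertex_eq r hr]; exact hx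
    rw [halves_cons]
    simp only [List.nodup_cons, List.mem_cons, not_or]
    exact ⟨⟨h.ne p List.mem_cons_self, hnot _ rfl⟩, hnot _ hp.symm, ih hl⟩

theorem apply_mem_halves {σ : H → H} (hσ : IsPairing σ) {l : List (H × H)}
    (hl : ∀ p ∈ l, σ p.1 = p.2) {x : H} (hx : x ∈ halves l) : σ x ∈ halves l := by
  obtain ⟨p, hp, hxp⟩ := mem_halves.1 hx
  refine mem_halves.2 ⟨p, hp, ?_⟩
  rcases hxp with rfl | rfl
  · exact Or.inr (hl p hp)
  · left; rw [← hl p hp, hσ.apply_apply]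

/-- The pairs matched along a trail and at its two ends. -/
def closedLinks (x y : H) (l : List (H × H)) (hl : l ≠ []) : List (H × H) :=
  (x, (l.head hl).1) :: (links l ++ [((l.getLast hl).2, y)])

theorem halves_closedLinks (x y : H) {l : List (H × H)} (hl : l ≠ []) :
    halves (closedLinks x y l hl) = x :: (halves l ++ [y]) := by
  rw [closedLinks, halves_cons, halves_append, halves_links hl]
  simp [halves]

theorem length_closedLinks (x y : H) {l : List (H × H)} (hl : l ≠ []) :
    (closedLinks x y l hl).length = l.length + 1 := by
  have := List.length_pos_iff.2 hl
  simp only [closedLinks, List.length_cons, List.length_append, length_links, List.length_nil]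
  omega

/-- The counting bound needs the prescribed pairs to be disjoint. Interior half-edges of the trail
are matched among themselves and the two ends are not matched together, so the partners of the ends
are two further half-edges off the list, though at its vertices. -/
theorem IsClosedTrail.closedLinks {π : H → V} {σ : H → H} (hσ : IsPairing σ)
    {l : List (H × H)} (h : IsClosedTrail π σ l) : ∃ hl : l ≠ [], ∃ x y,
      (∃ q ∈ l, π q.1 = π x) ∧ (∃ q ∈ l, π q.1 = π y) ∧ (halves (closedLinks x y l hl)).Nodup ∧
      ∀ p ∈ closedLinks x y l hl, σ p.1 = p.2 := by
  obtain ⟨htr, hl, hx, hy, hne⟩ := h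
  refine ⟨hl, σ (l.head hl).1, σ (l.getLast hl).2, hx, hy, ?_, ?_⟩
  · have hnd := htr.nodup_halves
    have hlinks := forall_mem_links htr.chain
    rw [halves_closedLinks]
    have heq := halves_links hl
    set a := (l.head hl).1
    set b := (l.getLast hl).2
    have hab : a ∉ halves (links l) ∧ b ∉ halves (links l) := by
      rw [heq] at hnd
      simp only [List.cons_append, List.nodup_cons, List.mem_append, not_or,
        List.nodup_append] at hnd
      exact ⟨hnd.1.1, fun hb => hnd.2.2.2 b hb b (by simp) rfl⟩
    have hmem : ∀ z, z ∈ halves l → z = a ∨ z ∈ halves (links l) ∨ z = b := by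
      intro z hz; rw [heq] at hz; simpa using hz
    have h1 : σ a ∉ halves l := by
      intro hc
      rcases hmem _ hc with h | h | h
      · exact hσ.apply_ne _ h
      · have := apply_mem_halves hσ hlinks h
        rw [hσ.apply_apply] at this
        exact hab.1 this
      · exact hne h
    have h2 : σ b ∉ halves l := by
      intro hc
      rcases hmem _ hc with h | h | h
      · exact hne (by rw [← h, hσ.apply_apply])
      · have := apply_mem_halves hσ hlinks h
        rw [hσ.apply_apply] at this
        exact hab.2 this
      · exact hσ.apply_ne _ h
    have h3 : σ a ≠ σ b := by
      intro hc
      have hab' : a = b := by rw [← hσ.apply_apply a, hc, hσ.apply_apply]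
      rw [heq] at hnd
      simp only [List.cons_append, List.nodup_cons] at hnd
      exact hnd.1 (by simp [hab'])
    simp only [List.nodup_cons, List.mem_append, List.mem_singleton, not_or, List.nodup_append]
    refine ⟨⟨h1, h3⟩, hnd, by simp, ?_⟩
    rintro z hz w rfl rfl
    exact h2 hz
  · rw [ConfigModel.closedLinks, List.forall_mem_cons]
    refine ⟨hσ.apply_apply _, fun p hp => ?_⟩
    rcases List.mem_append.1 hp with hp | hp
    · exact forall_mem_links htr.chain p hp
    · rw [List.mem_singleton.1 hp]

end Count

/-! ### The union bound over trails -/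

section UnionBound

variable {V H : Type*} [Fintype H] [DecidableEq V] [DecidableEq H]

/-- The ordered pairs of different half-edges at the same vertex. -/
def siblingPairs (π : H → V) : Finset (H × H) := {p | p.1 ≠ p.2 ∧ π p.1 = π p.2}

theorem mem_siblingPairs {π : H → V} {p : H × H} :
    p ∈ siblingPairs π ↔ p.1 ≠ p.2 ∧ π p.1 = π p.2 := by simp [siblingPairs]

/-- The lists of length `k` of ordered pairs of different half-edges at the same vertex. -/
def siblingLists (π : H → V) (k : ℕ) : Finset (List (H × H)) :=
  (Fintype.piFinset fun _ : Fin k => siblingPairs π).image List.ofFn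

theorem card_siblingLists_le (π : H → V) (k : ℕ) :
    (siblingLists π k).card ≤ (siblingPairs π).card ^ k := by
  refine Finset.card_image_le.trans ?_
  simp

theorem length_of_mem_siblingLists {π : H → V} {k : ℕ} {l : List (H × H)}
    (hl : l ∈ siblingLists π k) : l.length = k := by
  obtain ⟨f, -, rfl⟩ := Finset.mem_image.1 hl
  simp

theorem IsTrail.mem_siblingLists {π : H → V} {σ : H → H} {l : List (H × H)}
    (hl : IsTrail π σ l) : l ∈ siblingLists π l.length := by
  refine Finset.mem_image.2 ⟨l.get, ?_, List.ofFn_get l⟩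
  rw [Fintype.mem_piFinset]
  exact fun i => mem_siblingPairs.2 ⟨hl.ne _ (l.get_mem i), hl.vertex_eq _ (l.get_mem i)⟩

/-- The half-edges at the vertices of a list. -/
def halfEdgesAt (π : H → V) (l : List (H × H)) : Finset H := {h | ∃ q ∈ l, π q.1 = π h}

theorem card_halfEdgesAt_le {π : H → V} {Δ : ℕ}
    (hΔ : ∀ v, ({h | π h = v} : Finset H).card ≤ Δ) (l : List (H × H)) :
    (halfEdgesAt π l).card ≤ l.length * Δ := by
  have hsub : halfEdgesAt π l ⊆
      (l.map fun p => π p.1).toFinset.biUnion fun v => ({h | π h = v} : Finset H) := by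
    intro h hh
    obtain ⟨q, hq, hqh⟩ := (Finset.mem_filter.1 hh).2
    refine Finset.mem_biUnion.2 ⟨π q.1, ?_, by simp [hqh]⟩
    rw [List.mem_toFinset]
    exact List.mem_map_of_mem (f := fun p : H × H => π p.1) hq
  refine (Finset.card_le_card hsub).trans
    ((Finset.card_biUnion_le_card_mul _ _ _ fun v _ => hΔ v).trans ?_)
  gcongr
  exact (List.toFinset_card_le _).trans (by simp)

theorem card_biUnion_le_real {ι β : Type*} [DecidableEq β] {s : Finset ι} {f : ι → Finset β}
    {c : ℝ} (h : ∀ i ∈ s, ((f i).card : ℝ) ≤ c) : ((s.biUnion f).card : ℝ) ≤ s.card * c := by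
  calc ((s.biUnion f).card : ℝ) ≤ ((∑ i ∈ s, (f i).card : ℕ) : ℝ) := by
        exact_mod_cast Finset.card_biUnion_le
    _ ≤ s.card * c := by
        rw [Nat.cast_sum]
        exact (Finset.sum_le_card_nsmul s _ c h).trans_eq (nsmul_eq_mul _ _)

-- Union bound over the list of sibling pairs and the two partners `x`, `y` of its ends. A closed
-- trail of `k` vertices prescribes `k - 1` inner links and two closing ones, whence the exponent `k
-- + 1`.
open Classical in
theorem card_isClosedTrail_length_le {π : H → V} {Δ : ℕ}
    (hΔ : ∀ v, ({h | π h = v} : Finset H).card ≤ Δ) {q : ℝ} (hq : 0 < q) {k : ℕ}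
    (hqk : q + 2 * (k + 1) ≤ Fintype.card H + 1) :
    (({σ ∈ pairings H | ∃ l, l.length = k ∧ IsClosedTrail π σ l} : Finset (H → H)).card : ℝ) ≤
      (siblingPairs π).card ^ k * (k * Δ) ^ 2 / q ^ (k + 1) * (pairings H).card := by
  set B : ℝ := (pairings H).card / q ^ (k + 1) with hB
  have hB0 : 0 ≤ B := by positivity
  -- Disjointness of the pairs is part of `F`, so degenerate choices give the empty set and the
  -- bound `B` holds for all `x` and `y`.
  set F : List (H × H) → H → H → Finset (H → H) := fun l x y =>
    {σ ∈ pairings H | ∃ hl : l ≠ [], (halves (closedLinks x y l hl)).Nodup ∧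
      ∀ p ∈ closedLinks x y l hl, σ p.1 = p.2} with hF
  have hFB : ∀ l, l.length = k → ∀ x y, ((F l x y).card : ℝ) ≤ B := by
    intro l hlk x y
    by_cases h : ∃ hl : l ≠ [], (halves (closedLinks x y l hl)).Nodup
    · obtain ⟨hl, hnd⟩ := h
      have hlen := length_closedLinks x y hl
      rw [hlk] at hlen
      have := card_pairingsContaining_mul_le hq.le hnd (by rw [hlen]; push_cast; exact hqk)
      rw [hlen, ← le_div_iff₀ (by positivity)] at this
      refine le_trans ?_ this
      norm_cast
      refine Finset.card_le_card fun σ hσ => ?_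
      simp only [hF, Finset.mem_filter] at hσ
      exact mem_pairingsContaining.2
        ⟨(Finset.mem_filter.1 hσ.1).2, hσ.2.choose_spec.2⟩
    · have : F l x y = ∅ := by
        refine Finset.filter_eq_empty_iff.2 fun σ _ hc => h ?_
        obtain ⟨hl, hnd, -⟩ := hc
        exact ⟨hl, hnd⟩
      rw [this]
      simpa using hB0
  have hat : ∀ l, l.length = k → ((halfEdgesAt π l).card : ℝ) ≤ k * Δ := by
    intro l hlk
    rw [← hlk]
    exact_mod_cast card_halfEdgesAt_le hΔ l
  have hsub : ({σ ∈ pairings H | ∃ l, l.length = k ∧ IsClosedTrail π σ l} : Finset (H → H)) ⊆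
      (siblingLists π k).biUnion fun l => (halfEdgesAt π l).biUnion fun x =>
        (halfEdgesAt π l).biUnion fun y => F l x y := by
    intro σ hσ
    obtain ⟨hσ, l, hlk, hl⟩ := Finset.mem_filter.1 hσ
    obtain ⟨hne, x, y, hx, hy, hnd, hmem⟩ := hl.closedLinks (Finset.mem_filter.1 hσ).2
    simp only [Finset.mem_biUnion]
    refine ⟨l, hlk ▸ hl.1.mem_siblingLists, x, ?_, y, ?_, ?_⟩
    · simpa [halfEdgesAt] using hx
    · simpa [halfEdgesAt] using hy
    · exact Finset.mem_filter.2 ⟨hσ, hne, hnd, hmem⟩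
  calc _ ≤ (((siblingLists π k).biUnion fun l => (halfEdgesAt π l).biUnion fun x =>
        (halfEdgesAt π l).biUnion fun y => F l x y).card : ℝ) := by
        exact_mod_cast Finset.card_le_card hsub
    _ ≤ (siblingLists π k).card * ((k * Δ) * ((k * Δ) * B)) := by
        refine card_biUnion_le_real fun l hl => ?_
        have hlk := length_of_mem_siblingLists hl
        refine (card_biUnion_le_real (c := (k * Δ) * B) fun x _ => ?_).trans ?_
        · refine (card_biUnion_le_real (c := B) fun y _ => hFB l hlk x y).trans ?_
          gcongr
          exact hat l hlk
        · gcongr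
          exact hat l hlk
    _ ≤ (siblingPairs π).card ^ k * ((k * Δ) * ((k * Δ) * B)) := by
        gcongr
        exact_mod_cast card_siblingLists_le π k
    _ = _ := by rw [hB]; ring

-- Without closure there are only `L - 1` links for `L` vertices, so one factor `q` is lost compared
-- with `S ^ L / q ^ L`; for large `L` the geometric decay absorbs it.
open Classical in
theorem card_isTrail_length_le {π : H → V} {q : ℝ} (hq : 0 < q) {L : ℕ}
    (hqL : q + 2 * L ≤ Fintype.card H + 1) :
    (({σ ∈ pairings H | ∃ l, l.length = L ∧ IsTrail π σ l} : Finset (H → H)).card : ℝ) ≤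
      (siblingPairs π).card ^ L / q ^ (L - 1) * (pairings H).card := by
  set B : ℝ := (pairings H).card / q ^ (L - 1) with hB
  have hB0 : 0 ≤ B := by positivity
  set F : List (H × H) → Finset (H → H) := fun l =>
    {σ ∈ pairings H | (halves l).Nodup ∧ ∀ p ∈ links l, σ p.1 = p.2} with hF
  have hFB : ∀ l, l.length = L → ((F l).card : ℝ) ≤ B := by
    intro l hlL
    by_cases hnd : (halves l).Nodup
    · have hnd' : (halves (links l)).Nodup := by
        by_cases hl : l = []
        · simp [hl, links, halves]
        · rw [halves_links hl] at hnd
          exact (List.nodup_append.1 (List.nodup_cons.1 hnd).2).1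
      have hlen := length_links l
      rw [hlL] at hlen
      have := card_pairingsContaining_mul_le hq.le hnd' (by
        rw [hlen]
        have : ((L - 1 : ℕ) : ℝ) ≤ L := by exact_mod_cast Nat.sub_le L 1
        linarith)
      rw [hlen, ← le_div_iff₀ (by positivity)] at this
      refine le_trans ?_ this
      norm_cast
      refine Finset.card_le_card fun σ hσ => ?_
      simp only [hF, Finset.mem_filter] at hσ
      exact mem_pairingsContaining.2 ⟨(Finset.mem_filter.1 hσ.1).2, hσ.2.2⟩
    · have : F l = ∅ := Finset.filter_eq_empty_iff.2 fun σ _ hc => hnd hc.1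
      rw [this]
      simpa using hB0
  have hsub : ({σ ∈ pairings H | ∃ l, l.length = L ∧ IsTrail π σ l} : Finset (H → H)) ⊆
      (siblingLists π L).biUnion F := by
    intro σ hσ
    obtain ⟨hσ, l, hlL, hl⟩ := Finset.mem_filter.1 hσ
    exact Finset.mem_biUnion.2 ⟨l, hlL ▸ hl.mem_siblingLists,
      Finset.mem_filter.2 ⟨hσ, hl.nodup_halves, forall_mem_links hl.chain⟩⟩
  calc _ ≤ (((siblingLists π L).biUnion F).card : ℝ) := by
        exact_mod_cast Finset.card_le_card hsub
    _ ≤ (siblingLists π L).card * B :=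
        card_biUnion_le_real fun l hl => hFB l (length_of_mem_siblingLists hl)
    _ ≤ (siblingPairs π).card ^ L * B := by
        gcongr
        exact_mod_cast card_siblingLists_le π L
    _ = _ := by rw [hB]; ring

-- The hypothesis on `q` only allows prescribing about `L` pairs, so a closed trail with at least
-- `L` vertices is replaced by its initial segment of length `L`, which is still a trail.
open Classical in
theorem card_isClosedTrail_le {π : H → V} {Δ : ℕ}
    (hΔ : ∀ v, ({h | π h = v} : Finset H).card ≤ Δ) {q : ℝ} (hq : 0 < q) {L : ℕ}
    (hqL : q + 2 * L ≤ Fintype.card H + 1) :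
    (({σ ∈ pairings H | ∃ l, IsClosedTrail π σ l} : Finset (H → H)).card : ℝ) ≤
      (∑ k ∈ Finset.range L, (siblingPairs π).card ^ k * (k * Δ) ^ 2 / q ^ (k + 1) +
        (siblingPairs π).card ^ L / q ^ (L - 1)) * (pairings H).card := by
  have hsub : ({σ ∈ pairings H | ∃ l, IsClosedTrail π σ l} : Finset (H → H)) ⊆
      ((Finset.range L).biUnion fun k =>
        {σ ∈ pairings H | ∃ l, l.length = k ∧ IsClosedTrail π σ l}) ∪
      {σ ∈ pairings H | ∃ l, l.length = L ∧ IsTrail π σ l} := by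
    intro σ hσ
    obtain ⟨hσ, l, hl⟩ := Finset.mem_filter.1 hσ
    rw [Finset.mem_union]
    by_cases hlL : l.length < L
    · exact Or.inl (Finset.mem_biUnion.2
        ⟨l.length, Finset.mem_range.2 hlL, Finset.mem_filter.2 ⟨hσ, l, rfl, hl⟩⟩)
    · refine Or.inr (Finset.mem_filter.2 ⟨hσ, l.take L, ?_, hl.1.take L⟩)
      rw [List.length_take]
      omega
  have h1 := (Finset.card_le_card hsub).trans ((Finset.card_union_le _ _).trans
    (Nat.add_le_add_right Finset.card_biUnion_le _))
  rw [add_mul, Finset.sum_mul]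
  refine (Nat.cast_le.2 h1).trans ?_
  push_cast
  refine add_le_add (Finset.sum_le_sum fun k hk => ?_) (card_isTrail_length_le hq hqL)
  refine card_isClosedTrail_length_le hΔ hq ?_
  have : (k : ℝ) + 1 ≤ L := by exact_mod_cast Finset.mem_range.1 hk
  linarith

end UnionBound

/-! ### Configurations as pairings -/

section Partner

variable {n : ℕ} {d : Fin n → ℕ}

theorem Configuration.exists_partner (M : Configuration d) (h : HalfEdge d) :
    ∃ h', s(h, h') ∈ M.1 := by
  obtain ⟨p, ⟨hp, hhp⟩, -⟩ := M.2.2 h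
  obtain ⟨h', rfl⟩ := Sym2.mem_iff_exists.1 hhp
  exact ⟨h', hp⟩

/-- The half-edge with which a half-edge is matched. -/
noncomputable def Configuration.partner (M : Configuration d) (h : HalfEdge d) : HalfEdge d :=
  (M.exists_partner h).choose

theorem Configuration.mk_partner_mem (M : Configuration d) (h : HalfEdge d) :
    s(h, M.partner h) ∈ M.1 := (M.exists_partner h).choose_spec

theorem Configuration.eq_mk_partner (M : Configuration d) {p : Sym2 (HalfEdge d)} (hp : p ∈ M.1)
    {h : HalfEdge d} (hh : h ∈ p) : p = s(h, M.partner h) :=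
  (M.2.2 h).unique ⟨hp, hh⟩ ⟨M.mk_partner_mem h, Sym2.mem_mk_left _ _⟩

theorem Configuration.partner_eq (M : Configuration d) {h h' : HalfEdge d}
    (hp : s(h, h') ∈ M.1) : M.partner h = h' :=
  (Sym2.congr_right.1 (M.eq_mk_partner hp (Sym2.mem_mk_left _ _))).symm

theorem Configuration.isPairing_partner (M : Configuration d) : IsPairing M.partner where
  apply_apply h := M.partner_eq (by rw [Sym2.eq_swap]; exact M.mk_partner_mem h)
  apply_ne h hc := M.2.1 _ (M.mk_partner_mem h) (by rw [hc]; exact Sym2.mk_isDiag_iff.2 rfl)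

theorem Configuration.partner_injective :
    Function.Injective (Configuration.partner : Configuration d → HalfEdge d → HalfEdge d) := by
  intro M M' h
  have hsub : ∀ M M' : Configuration d, M.partner = M'.partner → M.1 ⊆ M'.1 := by
    intro M M' h p hp
    induction p with
    | _ a b =>
      rw [← M.partner_eq hp, h]
      exact M'.mk_partner_mem a
  exact Subtype.ext ((hsub M M' h).antisymm (hsub M' M h.symm))

theorem Configuration.exists_partner_eq {σ : HalfEdge d → HalfEdge d} (hσ : IsPairing σ) :
    ∃ M : Configuration d, M.partner = σ := by
  have hM : IsPerfectMatching (Finset.univ.image fun h : HalfEdge d => s(h, σ h)) := by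
    refine ⟨?_, fun h => ⟨s(h, σ h), ⟨Finset.mem_image_of_mem _ (Finset.mem_univ h),
      Sym2.mem_mk_left _ _⟩, ?_⟩⟩
    · intro p hp
      obtain ⟨h, -, rfl⟩ := Finset.mem_image.1 hp
      rw [Sym2.mk_isDiag_iff]
      exact (hσ.apply_ne h).symm
    · rintro p ⟨hp, hhp⟩
      obtain ⟨h', -, rfl⟩ := Finset.mem_image.1 hp
      rcases Sym2.mem_iff.1 hhp with rfl | rfl
      · rfl
      · rw [hσ.apply_apply, Sym2.eq_swap]
  refine ⟨⟨_, hM⟩, funext fun h => ?_⟩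
  exact Configuration.partner_eq _ (Finset.mem_image_of_mem _ (Finset.mem_univ h))

theorem Configuration.isLink_iff (M : Configuration d) {p : Sym2 (HalfEdge d)} {u v : Fin n} :
    (underlyingMultigraph M).IsLink p u v ↔
      ∃ h, p = s(h, M.partner h) ∧ h.1 = u ∧ (M.partner h).1 = v := by
  constructor
  · rintro ⟨hp, huv⟩
    induction p with
    | _ a b =>
      rw [Sym2.map_mk, Sym2.eq_iff] at huv
      rcases huv with ⟨h1, h2⟩ | ⟨h1, h2⟩
      · exact ⟨a, M.eq_mk_partner hp (Sym2.mem_mk_left _ _), h1, by rw [M.partner_eq hp]; exact h2⟩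
      · refine ⟨b, M.eq_mk_partner hp (Sym2.mem_mk_right _ _), h2, ?_⟩
        rw [Sym2.eq_swap] at hp
        rw [M.partner_eq hp]; exact h1
  · rintro ⟨h, rfl, rfl, rfl⟩
    exact ⟨M.mk_partner_mem h, rfl⟩

end Partner

/-! ### Two cycles in a component -/

section TwoCycles

/-- A cyclic sequence cannot change sides exactly once: the shift preserves the number of indices
satisfying `P`, while a single change would make one of the two index sets strictly contain the
other. -/
theorem iff_of_forall_ne_iff_add_one {k : ℕ} {P : Fin (k + 1) → Prop} {i : Fin (k + 1)}
    (h : ∀ j ≠ i, (P j ↔ P (j + 1))) : P i ↔ P (i + 1) := by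
  classical
  have hcard : ({j | P (j + 1)} : Finset (Fin (k + 1))).card =
      ({j | P j} : Finset (Fin (k + 1))).card :=
    Finset.card_equiv (Equiv.addRight 1) (by simp)
  constructor
  · intro hi
    by_contra hi'
    refine hcard.not_lt (Finset.card_lt_card (Finset.ssubset_iff_of_subset ?_ |>.2
      ⟨i, by simpa using hi, by simpa using hi'⟩))
    intro j hj
    simp only [Finset.mem_filter, Finset.mem_univ, true_and] at hj ⊢
    exact (h j (by rintro rfl; exact hi' hj)).2 hj
  · intro hi'
    by_contra hi
    refine hcard.not_gt (Finset.card_lt_card (Finset.ssubset_iff_of_subset ?_ |>.2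
      ⟨i, by simpa using hi', by simpa using hi⟩))
    intro j hj
    simp only [Finset.mem_filter, Finset.mem_univ, true_and] at hj ⊢
    exact (h j (by rintro rfl; exact hi hj)).1 hj

theorem IsCycle.mem_vertexSet_iff {α β : Type*} {C : Graph α β} (hC : IsCycle C) {x : α} :
    x ∈ C.vertexSet ↔ ∃ e, C.Inc e x := by
  refine ⟨fun hx => ?_, fun ⟨e, he⟩ => he.vertex_mem⟩
  obtain ⟨k, v, e, -, -, hv, -, hlink⟩ := hC
  rw [hv] at hx
  obtain ⟨i, rfl⟩ := hx
  exact ⟨e i, (hlink i).inc_left⟩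

/-- Every vertex of a cycle lies on one of its edges, so inside a fixed graph the edges determine
the cycle. Two different cycles are thus distinguished by an edge. -/
theorem IsCycle.eq_of_edgeSet_eq {α β : Type*} {G C C' : Graph α β} (hC : IsCycle C)
    (hC' : IsCycle C') (h : C ≤ G) (h' : C' ≤ G) (he : C.edgeSet = C'.edgeSet) : C = C' := by
  have hlink : ∀ e x y, C.IsLink e x y ↔ C'.IsLink e x y := by
    intro e x y
    by_cases hmem : e ∈ C.edgeSet
    · rw [h.isLink_iff hmem, h'.isLink_iff (he ▸ hmem)]
    · exact ⟨fun hl => absurd hl.edge_mem hmem, fun hl => absurd (he ▸ hl.edge_mem) hmem⟩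
  refine Graph.ext (Set.ext fun x => ?_) hlink
  rw [hC.mem_vertexSet_iff, hC'.mem_vertexSet_iff]
  simp only [Graph.Inc, hlink]

variable {n : ℕ} {d : Fin n → ℕ}

theorem IsCycle.exists_halfEdges {M : Configuration d} {C : Graph (Fin n) (Sym2 (HalfEdge d))}
    (hC : IsCycle C) (hCM : C ≤ underlyingMultigraph M) :
    ∃ (W : Finset (Fin n)) (K : Finset (HalfEdge d)), (W : Set (Fin n)) = C.vertexSet ∧
      W.Nonempty ∧ (∀ h ∈ K, M.partner h ∈ K) ∧ (∀ h ∈ K, h.1 ∈ W) ∧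
      (∀ h ∈ K, s(h, M.partner h) ∈ C.edgeSet) ∧ 2 * W.card ≤ K.card := by
  classical
  obtain ⟨k, v, e, hv, he, hV, hE, hlink⟩ := hC
  set K : Finset (HalfEdge d) := {h | s(h, M.partner h) ∈ C.edgeSet} with hK
  have hmemK : ∀ h, h ∈ K ↔ s(h, M.partner h) ∈ C.edgeSet := fun h => by simp [hK]
  have hpart : ∀ h ∈ K, M.partner h ∈ K := by
    intro h hh
    rw [hmemK] at hh ⊢
    rwa [M.isPairing_partner.apply_apply, Sym2.eq_swap]
  refine ⟨Finset.univ.image v, K, by rw [hV]; simp, ⟨v 0, by simp⟩, hpart, ?_,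
    fun h hh => (hmemK h).1 hh, ?_⟩
  · intro h hh
    rw [← Finset.mem_coe, Finset.coe_image, Finset.coe_univ, Set.image_univ, ← hV]
    obtain ⟨x, y, hxy⟩ := Graph.exists_isLink_of_mem_edgeSet ((hmemK h).1 hh)
    rcases Graph.IsLink.left_eq_or_eq
      ((M.isLink_iff (p := s(h, M.partner h))).2 ⟨h, rfl, rfl, rfl⟩) (hxy.mono hCM) with h1 | h1
    · rw [h1]; exact hxy.left_mem
    · rw [h1]; exact hxy.right_mem
  · rw [Finset.card_image_of_injective _ hv, Finset.card_univ, Fintype.card_fin]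
    have hmaps : ∀ h ∈ K, s(h, M.partner h) ∈ Finset.univ.image e := by
      intro h hh
      have := (hmemK h).1 hh
      rw [hE] at this
      simpa using this
    rw [Finset.card_eq_sum_card_fiberwise hmaps]
    have hfib : ∀ p ∈ Finset.univ.image e,
        2 ≤ ({h ∈ K | s(h, M.partner h) = p} : Finset (HalfEdge d)).card := by
      intro p hp
      obtain ⟨i, -, rfl⟩ := Finset.mem_image.1 hp
      obtain ⟨h, hh, -⟩ := M.isLink_iff.1 ((hlink i).mono hCM)
      have hhK : h ∈ K := by rw [hmemK, ← hh]; exact (hlink i).edge_mem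
      rw [← Finset.card_pair (M.isPairing_partner.apply_ne h).symm]
      refine Finset.card_le_card fun x hx => ?_
      rw [Finset.mem_insert, Finset.mem_singleton] at hx
      rcases hx with rfl | rfl
      · exact Finset.mem_filter.2 ⟨hhK, hh.symm⟩
      · refine Finset.mem_filter.2 ⟨hpart _ hhK, ?_⟩
        rw [M.isPairing_partner.apply_apply, hh, Sym2.eq_swap]
    have := Finset.card_nsmul_le_sum _ _ 2 hfib
    rw [Finset.card_image_of_injective _ he, Finset.card_univ, Fintype.card_fin,
      smul_eq_mul] at this
    omega

theorem card_insert_pair [DecidableEq (HalfEdge d)] {M : Configuration d}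
    {K : Finset (HalfEdge d)} (hK : ∀ h ∈ K, M.partner h ∈ K) {a : HalfEdge d} (ha : a ∉ K) :
    (insert a (insert (M.partner a) K)).card = K.card + 2 := by
  have hb : M.partner a ∉ K := fun h => ha (by
    rw [← M.isPairing_partner.apply_apply a]; exact hK _ h)
  rw [Finset.card_insert_of_notMem, Finset.card_insert_of_notMem hb]
  rw [Finset.mem_insert, not_or]
  exact ⟨(M.isPairing_partner.apply_ne a).symm, ha⟩

theorem partner_mem_insert_pair [DecidableEq (HalfEdge d)] {M : Configuration d}
    {K : Finset (HalfEdge d)} (hK : ∀ h ∈ K, M.partner h ∈ K) {a : HalfEdge d} :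
    ∀ h ∈ insert a (insert (M.partner a) K),
      M.partner h ∈ insert a (insert (M.partner a) K) := by
  intro h hh
  simp only [Finset.mem_insert] at hh ⊢
  rcases hh with rfl | rfl | hh
  · exact Or.inr (Or.inl rfl)
  · exact Or.inl (M.isPairing_partner.apply_apply a)
  · exact Or.inr (Or.inr (hK h hh))

/-- Grow `C'` one edge and one new vertex at a time, never using `p`; the number of edges stays at
least the number of vertices. A maximal such set is the whole component, since `C` without `p` still
joins the ends of `p`. The unused edge `p` then makes the inequality strict. -/
theorem exists_internalHalfEdges_of_edge {M : Configuration d}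
    {K C C' : Graph (Fin n) (Sym2 (HalfEdge d))} (hKM : K ≤ underlyingMultigraph M)
    (hK : IsConnected K) (hCK : C ≤ K) (hCK' : C' ≤ K) (hC : IsCycle C) (hC' : IsCycle C')
    {p : Sym2 (HalfEdge d)} (hp : p ∈ C.edgeSet) (hp' : p ∉ C'.edgeSet) :
    ∃ W : Finset (Fin n),
      2 * W.card < (internalHalfEdges (Sigma.fst : HalfEdge d → Fin n) M.partner W).card := by
  classical
  let Q : Finset (Fin n) → Prop := fun W => W.Nonempty ∧ (W : Set (Fin n)) ⊆ K.vertexSet ∧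
    ∃ F : Finset (HalfEdge d), (∀ h ∈ F, M.partner h ∈ F) ∧ (∀ h ∈ F, h.1 ∈ W) ∧
      (∀ h ∈ F, s(h, M.partner h) ≠ p) ∧ 2 * W.card ≤ F.card
  have hQ : ∃ W, Q W := by
    obtain ⟨W, F, hW, hne, h1, h2, h3, h4⟩ := hC'.exists_halfEdges (hCK'.trans hKM)
    exact ⟨W, hne, hW ▸ hCK'.vertexSet_mono, F, h1, h2, fun h hh hc => hp' (hc ▸ h3 h hh), h4⟩
  obtain ⟨W, hW, hmax⟩ := Finset.exists_max_image ({W | Q W} : Finset (Finset (Fin n)))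
    Finset.card (by obtain ⟨W, hW⟩ := hQ; exact ⟨W, by simpa using hW⟩)
  obtain ⟨⟨u₀, hu₀⟩, hWK, F, hF1, hF2, hF3, hF4⟩ : Q W := by simpa using hW
  -- An edge other than `p` leaving `W` could be added with its outer end, against maximality.
  have hcross : ∀ r u w, K.IsLink r u w → u ∈ W → r ≠ p → w ∈ W := by
    intro r u w hr hu hrp
    by_contra hw
    obtain ⟨a, ha, rfl, rfl⟩ := M.isLink_iff.1 (hr.mono hKM)
    have haF : a ∉ F := fun h => hw (hF2 _ (hF1 a h))
    have hQ' : Q (insert (M.partner a).1 W) := by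
      refine ⟨⟨u₀, Finset.mem_insert_of_mem hu₀⟩, ?_, insert a (insert (M.partner a) F),
        partner_mem_insert_pair hF1, ?_, ?_, ?_⟩
      · rw [Finset.coe_insert]
        exact Set.insert_subset hr.right_mem hWK
      · intro h hh
        rw [Finset.mem_insert, Finset.mem_insert] at hh
        rcases hh with rfl | rfl | hh
        · exact Finset.mem_insert_of_mem hu
        · exact Finset.mem_insert_self _ _
        · exact Finset.mem_insert_of_mem (hF2 h hh)
      · intro h hh
        rw [Finset.mem_insert, Finset.mem_insert] at hh
        rcases hh with rfl | rfl | hh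
        · exact ha ▸ hrp
        · rw [M.isPairing_partner.apply_apply, Sym2.eq_swap]; exact ha ▸ hrp
        · exact hF3 h hh
      · rw [card_insert_pair hF1 haF, Finset.card_insert_of_notMem hw]
        omega
    have := hmax _ (by simpa using hQ')
    rw [Finset.card_insert_of_notMem hw] at this
    omega
  have hall : ∀ u w, K.Adj u w → u ∈ W → w ∈ W := by
    rintro u w ⟨r, hr⟩ hu
    by_cases hrp : r = p
    · subst hrp
      obtain ⟨k, v, e, -, he, -, hE, hlink⟩ := hC
      rw [hE] at hp
      obtain ⟨i, rfl⟩ := hp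
      -- All other edges of `C` respect `W`, so `p` cannot be the only edge of the cycle crossing
      -- its boundary.
      have hiff : v i ∈ W ↔ v (i + 1) ∈ W := by
        refine iff_of_forall_ne_iff_add_one (P := fun j => v j ∈ W) fun j hj => ?_
        have hl := (hlink j).mono hCK
        exact ⟨fun h => hcross _ _ _ hl h (he.ne hj), fun h => hcross _ _ _ hl.symm h (he.ne hj)⟩
      rcases hr.eq_and_eq_or_eq_and_eq ((hlink i).mono hCK) with ⟨rfl, rfl⟩ | ⟨rfl, rfl⟩
      · exact hiff.1 hu
      · exact hiff.2 hu
    · exact hcross r u w hr hu hrp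
  have hVW : ∀ w ∈ K.vertexSet, w ∈ W := by
    intro w hw
    have := hK.2 u₀ (hWK hu₀) w hw
    induction this with
    | refl => exact hu₀
    | tail _ h ih => exact hall _ _ h (ih h.left_mem)
  obtain ⟨x, y, hxy⟩ := Graph.exists_isLink_of_mem_edgeSet hp
  have hxy' := hxy.mono hCK
  obtain ⟨a, ha, rfl, rfl⟩ := M.isLink_iff.1 (hxy'.mono hKM)
  have haF : a ∉ F := fun h => hF3 a h ha.symm
  have hW' : ∀ h ∈ insert a (insert (M.partner a) F), h.1 ∈ W := by
    intro h hh
    rw [Finset.mem_insert, Finset.mem_insert] at hh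
    rcases hh with rfl | rfl | hh
    · exact hVW _ hxy'.left_mem
    · exact hVW _ hxy'.right_mem
    · exact hF2 h hh
  refine ⟨W, lt_of_lt_of_le ?_ (Finset.card_le_card (s := insert a (insert (M.partner a) F))
    fun h hh => ?_)⟩
  · rw [card_insert_pair hF1 haF]
    omega
  · exact Finset.mem_filter.2
      ⟨Finset.mem_univ _, hW' h hh, hW' _ (partner_mem_insert_pair hF1 h hh)⟩

theorem HasComponentWithTwoCycles.exists_isClosedTrail {M : Configuration d}
    (h : HasComponentWithTwoCycles (underlyingMultigraph M)) :
    ∃ l, IsClosedTrail (Sigma.fst : HalfEdge d → Fin n) M.partner l := by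
  obtain ⟨K, hK, C₁, C₂, h1, h2, hC1, hC2, hne⟩ := h
  obtain ⟨hKM, hKc⟩ := hK.prop
  have hE : C₁.edgeSet ≠ C₂.edgeSet := fun he =>
    hne (hC1.eq_of_edgeSet_eq hC2 h1 h2 he)
  obtain ⟨W, hW⟩ : ∃ W : Finset (Fin n),
      2 * W.card < (internalHalfEdges (Sigma.fst : HalfEdge d → Fin n) M.partner W).card := by
    by_cases hsub : C₁.edgeSet ⊆ C₂.edgeSet
    · obtain ⟨p, hp, hp'⟩ := Set.not_subset.1 fun hsub' => hE (hsub.antisymm hsub')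
      exact exists_internalHalfEdges_of_edge hKM hKc h2 h1 hC2 hC1 hp hp'
    · obtain ⟨p, hp, hp'⟩ := Set.not_subset.1 hsub
      exact exists_internalHalfEdges_of_edge hKM hKc h1 h2 hC1 hC2 hp hp'
  exact ConfigModel.exists_isClosedTrail M.isPairing_partner hW

end TwoCycles

/-! ### The probability of two cycles in a component -/

section Law

variable {n : ℕ} {d : Fin n → ℕ}

instance : Finite (Configuration d) := Subtype.finite

theorem card_fiber_fst (d : Fin n → ℕ) (v : Fin n) :
    ({h | h.1 = v} : Finset (HalfEdge d)).card = d v := by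
  have : ({h | h.1 = v} : Finset (HalfEdge d)) =
      Finset.univ.map ⟨Sigma.mk v, sigma_mk_injective⟩ := by
    ext ⟨u, i⟩
    simp only [Finset.mem_filter, Finset.mem_univ, true_and, Finset.mem_map,
      Function.Embedding.coeFn_mk]
    constructor
    · rintro rfl; exact ⟨i, rfl⟩
    · rintro ⟨j, hj⟩; cases hj; rfl
  rw [this, Finset.card_map, Finset.card_univ, Fintype.card_fin]

theorem card_siblingPairs_le (d : Fin n → ℕ) :
    ((siblingPairs (Sigma.fst : HalfEdge d → Fin n)).card : ℝ) ≤
      ∑ v, ((d v : ℝ) ^ 2 - d v) := by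
  have hsub : siblingPairs (Sigma.fst : HalfEdge d → Fin n) ⊆
      Finset.univ.biUnion fun v => ({h | h.1 = v} : Finset (HalfEdge d)).offDiag := by
    intro p hp
    rw [mem_siblingPairs] at hp
    refine Finset.mem_biUnion.2 ⟨p.1.1, Finset.mem_univ _, Finset.mem_offDiag.2 ?_⟩
    simp [hp.1, hp.2]
  have h1 := (Finset.card_le_card hsub).trans Finset.card_biUnion_le
  refine (Nat.cast_le.2 h1).trans ?_
  rw [Nat.cast_sum]
  refine Finset.sum_le_sum fun v _ => ?_
  rw [Finset.offDiag_card, card_fiber_fst, Nat.cast_sub (Nat.le_mul_self _)]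
  push_cast
  rw [sq]

theorem exists_isPairing {H : Type*} [Fintype H] (h : Even (Fintype.card H)) :
    ∃ σ : H → H, IsPairing σ := by
  obtain ⟨m, hm⟩ := h
  let e : H ≃ Fin m × Bool := Fintype.equivOfCardEq (by simp [hm]; ring)
  refine ⟨fun h => e.symm ((e h).1, !(e h).2), fun h => by simp, fun h hc => ?_⟩
  rw [Equiv.symm_apply_eq] at hc
  simpa using congrArg Prod.snd hc

/-- By the handshake lemma the number of half-edges is even, which is all that a perfect matching
requires. -/
theorem IsFeasible.nonempty_configuration (hd : IsFeasible d) : Nonempty (Configuration d) := by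
  classical
  obtain ⟨G, hG⟩ := hd
  have hdeg : ∀ v, G.degree v = d v := fun v => by
    rw [← hG v, ← SimpleGraph.card_neighborSet_eq_degree, Set.ncard_eq_toFinset_card',
      Set.toFinset_card]
  obtain ⟨σ, hσ⟩ := exists_isPairing (H := HalfEdge d) (by
    rw [Fintype.card_sigma]
    simp only [Fintype.card_fin, ← hdeg, G.sum_degrees_eq_twice_card_edges]
    exact even_two_mul _)
  exact ⟨(Configuration.exists_partner_eq hσ).choose⟩

theorem isProbabilityMeasure_configurationLaw [Nonempty (Configuration d)] :
    IsProbabilityMeasure (configurationLaw d) :=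
  isProbabilityMeasure_uniformOn Set.finite_univ Set.univ_nonempty

theorem configurationLaw_hasComponentWithTwoCycles_le [Nonempty (Configuration d)] {Δ : ℕ}
    (hΔ : ∀ v, d v ≤ Δ) {q : ℝ} (hq : 0 < q) {L : ℕ} (hqL : q + 2 * L ≤ ∑ v, (d v : ℝ)) :
    configurationLaw d {M | HasComponentWithTwoCycles (underlyingMultigraph M)} ≤
      ENNReal.ofReal (∑ k ∈ Finset.range L,
        (∑ v, ((d v : ℝ) ^ 2 - d v)) ^ k * (k * Δ) ^ 2 / q ^ (k + 1) +
          (∑ v, ((d v : ℝ) ^ 2 - d v)) ^ L / q ^ (L - 1)) := by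
  classical
  have := Fintype.ofFinite (Configuration d)
  have hcardH : (Fintype.card (HalfEdge d) : ℝ) = ∑ v, (d v : ℝ) := by
    rw [Fintype.card_sigma]; simp
  set S : ℝ := ∑ v, ((d v : ℝ) ^ 2 - d v) with hS
  have hSle : _ ≤ S := card_siblingPairs_le d
  set B : ℝ := ∑ k ∈ Finset.range L, S ^ k * (k * Δ) ^ 2 / q ^ (k + 1) + S ^ L / q ^ (L - 1)
    with hB
  have hS0 : 0 ≤ S := (Nat.cast_nonneg _).trans hSle
  have htotal : (pairings (HalfEdge d)).card = Fintype.card (Configuration d) := by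
    rw [← Finset.card_univ]
    refine (Finset.card_bij (fun M _ => M.partner) ?_ ?_ ?_).symm
    · intro M _
      exact mem_pairings.2 M.isPairing_partner
    · intro M _ M' _ h
      exact Configuration.partner_injective h
    · intro σ hσ
      obtain ⟨M, hM⟩ := Configuration.exists_partner_eq (mem_pairings.1 hσ)
      exact ⟨M, Finset.mem_univ _, hM⟩
  -- Passing to `partner` transports the uniform law to uniform fixed-point-free involutions, where
  -- the trail count applies.
  have hbad : ({M | HasComponentWithTwoCycles (underlyingMultigraph M)} :
        Finset (Configuration d)).card ≤
      ({σ ∈ pairings (HalfEdge d) | ∃ l, IsClosedTrail (Sigma.fst : HalfEdge d → Fin n) σ l} :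
        Finset (HalfEdge d → HalfEdge d)).card := by
    refine Finset.card_le_card_of_injOn Configuration.partner (fun M hM => ?_)
      Configuration.partner_injective.injOn
    have hM' : HasComponentWithTwoCycles (underlyingMultigraph M) := by simpa using hM
    exact Finset.mem_filter.2 ⟨mem_pairings.2 M.isPairing_partner,
      hM'.exists_isClosedTrail⟩
  have hcount := card_isClosedTrail_le (π := (Sigma.fst : HalfEdge d → Fin n)) (Δ := Δ)
    (fun v => (card_fiber_fst d v).trans_le (hΔ v)) hq (L := L) (by rw [hcardH]; linarith)
  have hreal : (({M | HasComponentWithTwoCycles (underlyingMultigraph M)} :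
      Finset (Configuration d)).card : ℝ) ≤ B * Fintype.card (Configuration d) := by
    refine (Nat.cast_le.2 hbad).trans (hcount.trans ?_)
    rw [htotal, hB]
    gcongr
  have hset : {M : Configuration d | HasComponentWithTwoCycles (underlyingMultigraph M)} =
      (({M | HasComponentWithTwoCycles (underlyingMultigraph M)} : Finset (Configuration d)) :
        Set (Configuration d)) := by simp
  rw [configurationLaw, uniformOn_univ, hset, Measure.count_apply_finset]
  have hpos : (0 : ℝ) < Fintype.card (Configuration d) := by exact_mod_cast Fintype.card_pos
  refine ENNReal.div_le_of_le_mul ?_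
  rw [← ENNReal.ofReal_natCast, ← ENNReal.ofReal_natCast (Fintype.card _),
    ← ENNReal.ofReal_mul' hpos.le]
  exact ENNReal.ofReal_le_ofReal hreal

end Law

/-! ### Asymptotics -/

section Asymptotics

/-- The union bound over trails tends to zero in the subcritical regime. -/
theorem tendsto_trailBound {N S Δ : ℕ → ℝ} {ρ ε : ℝ} (hρ : 0 ≤ ρ) (hε : 0 < ε)
    (hρε : ρ < 1 - ε) (hS0 : ∀ n, 0 ≤ S n) (hS : ∀ᶠ n in atTop, S n ≤ ρ * N n)
    (hN : Tendsto N atTop atTop) (hΔ : Tendsto (fun n => Δ n ^ 2 / N n) atTop (𝓝 0)) :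
    Tendsto (fun n => ∑ k ∈ Finset.range ⌊ε * N n / 2⌋₊,
        S n ^ k * (k * Δ n) ^ 2 / ((1 - ε) * N n) ^ (k + 1) +
          S n ^ ⌊ε * N n / 2⌋₊ / ((1 - ε) * N n) ^ (⌊ε * N n / 2⌋₊ - 1)) atTop (𝓝 0) := by
  have hε1 : 0 < 1 - ε := hρ.trans_lt hρε
  set r : ℝ := ρ / (1 - ε) with hr
  have hr0 : 0 ≤ r := by positivity
  have hr1 : r < 1 := (div_lt_one hε1).2 hρε
  set L : ℕ → ℕ := fun n => ⌊ε * N n / 2⌋₊ with hL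
  have hLtop : Tendsto L atTop atTop :=
    tendsto_nat_floor_atTop.comp ((hN.const_mul_atTop hε).atTop_div_const two_pos)
  have hsum : Summable fun k : ℕ => (k : ℝ) ^ 2 * r ^ k :=
    summable_pow_mul_geometric_of_norm_lt_one 2 (by rwa [Real.norm_of_nonneg hr0])
  -- The constant `2 * (1 - ε) / ε` comes from `ε * N / 2 < L + 1`, which bounds `q = (1 - ε) * N`
  -- by this multiple of `L + 1`.
  have hlim : Tendsto (fun n => Δ n ^ 2 / N n * ((∑' k : ℕ, (k : ℝ) ^ 2 * r ^ k) / (1 - ε)) +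
      (2 * (1 - ε) / ε) * (L n * r ^ L n + r ^ L n)) atTop (𝓝 0) := by
    have h1 := hΔ.mul_const ((∑' k : ℕ, (k : ℝ) ^ 2 * r ^ k) / (1 - ε))
    have h2 := (((tendsto_self_mul_const_pow_of_lt_one hr0 hr1).add
      (tendsto_pow_atTop_nhds_zero_of_lt_one hr0 hr1)).comp hLtop).const_mul (2 * (1 - ε) / ε)
    simpa using h1.add h2
  refine tendsto_of_tendsto_of_tendsto_of_le_of_le' tendsto_const_nhds hlim ?_ ?_
  · filter_upwards [hN.eventually_gt_atTop 0] with n hn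
    have := hS0 n
    positivity
  -- `L ≥ 1` makes the natural subtraction in `L - 1` a true one.
  · filter_upwards [hN.eventually_gt_atTop 0, hS, hLtop.eventually_ge_atTop 1] with n hn hSn hLn
    have hS0n := hS0 n
    set q : ℝ := (1 - ε) * N n with hq
    have hq0 : 0 < q := by positivity
    have hSq : S n ≤ r * q := by
      refine hSn.trans_eq ?_
      rw [hr, hq]; field_simp
    refine add_le_add ?_ ?_
    · calc ∑ k ∈ Finset.range (L n), S n ^ k * (k * Δ n) ^ 2 / q ^ (k + 1)
          ≤ ∑ k ∈ Finset.range (L n), (Δ n ^ 2 / q) * ((k : ℝ) ^ 2 * r ^ k) := by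
            refine Finset.sum_le_sum fun k _ => ?_
            calc S n ^ k * (k * Δ n) ^ 2 / q ^ (k + 1)
                ≤ (r * q) ^ k * (k * Δ n) ^ 2 / q ^ (k + 1) := by gcongr
              _ = _ := by rw [mul_pow]; field_simp; ring
        _ ≤ (Δ n ^ 2 / q) * ∑' k : ℕ, (k : ℝ) ^ 2 * r ^ k := by
            rw [← Finset.mul_sum]
            gcongr
            exact hsum.sum_le_tsum _ fun k _ => by positivity
        _ = _ := by rw [hq]; field_simp
    · calc S n ^ L n / q ^ (L n - 1) ≤ (r * q) ^ L n / q ^ (L n - 1) := by gcongr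
        _ = q * r ^ L n := by
            obtain ⟨m, hm⟩ : ∃ m, L n = m + 1 := ⟨L n - 1, by omega⟩
            rw [hm, mul_pow, Nat.add_sub_cancel, pow_succ q m]
            field_simp
        _ ≤ ((2 * (1 - ε) / ε) * (L n + 1)) * r ^ L n := by
            gcongr
            have : ε * N n / 2 < L n + 1 := Nat.lt_floor_add_one _
            rw [hq, div_mul_eq_mul_div, le_div_iff₀ hε]
            nlinarith
        _ = _ := by ring

theorem integral_degreeDistribution {n : ℕ} (d : Fin n → ℕ) (f : ℕ → ℝ) :
    ∫ k, f k ∂(degreeDistribution d) = (∑ v, f (d v)) / n := by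
  rw [degreeDistribution, integral_map (measurable_of_finite _).aemeasurable
    (measurable_of_countable _).aestronglyMeasurable, uniformOn, ProbabilityTheory.cond, Measure.restrict_univ,
    integral_smul_measure, integral_count]
  simp [Measure.count_univ, div_eq_inv_mul]

end Asymptotics

/-! ### Consequences of regularity, and the limit of the probability. -/

section Regular

variable {d : (n : ℕ) → Fin n → ℕ} {D : Measure ℕ}

theorem IsRegular.integrable_id [IsProbabilityMeasure D] (hd : IsRegular d D) :
    Integrable (fun k : ℕ => (k : ℝ)) D := by
  refine hd.integrable_sq.mono' (measurable_of_countable _).aestronglyMeasurable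
    (Eventually.of_forall fun k => ?_)
  rw [Real.norm_of_nonneg (Nat.cast_nonneg _)]
  exact_mod_cast Nat.le_self_pow two_ne_zero k

theorem IsRegular.tendsto_sum_div (hd : IsRegular d D) :
    Tendsto (fun n => (∑ v, (d n v : ℝ)) / n) atTop (𝓝 (∫ k, (k : ℝ) ∂D)) := by
  have h := hd.tendsto_mean
  simp only [integral_degreeDistribution] at h
  exact h

theorem IsRegular.tendsto_sum_sq_div (hd : IsRegular d D) :
    Tendsto (fun n => (∑ v, (d n v : ℝ) ^ 2) / n) atTop (𝓝 (∫ k, (k : ℝ) ^ 2 ∂D)) := by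
  have h := hd.tendsto_sq
  simp only [integral_degreeDistribution (f := fun k => (k : ℝ) ^ 2)] at h
  exact h

/-- The maximal degree. -/
def maxDegree {n : ℕ} (d : Fin n → ℕ) : ℕ := Finset.univ.sup d

/-- The square of a degree, if the degree is at most `K`, and zero otherwise. -/
noncomputable def truncatedSq (K : ℕ) : ℕ →ᵇ ℝ :=
  BoundedContinuousFunction.ofNormedAddCommGroupDiscrete
    (fun k => if k ≤ K then (k : ℝ) ^ 2 else 0) ((K : ℝ) ^ 2) fun k => by
      split_ifs with h
      · rw [Real.norm_of_nonneg (by positivity)]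
        gcongr
      · rw [norm_zero]; positivity

theorem truncatedSq_apply (K k : ℕ) :
    truncatedSq K k = if k ≤ K then (k : ℝ) ^ 2 else 0 := rfl

theorem truncatedSq_le (K k : ℕ) : truncatedSq K k ≤ (k : ℝ) ^ 2 := by
  rw [truncatedSq_apply]
  split_ifs
  · exact le_rfl
  · positivity

theorem tendsto_integral_truncatedSq (hD : Integrable (fun k : ℕ => (k : ℝ) ^ 2) D) :
    Tendsto (fun K => ∫ k, truncatedSq K k ∂D) atTop (𝓝 (∫ k, (k : ℝ) ^ 2 ∂D)) := by
  refine tendsto_integral_of_dominated_convergence (fun k : ℕ => (k : ℝ) ^ 2)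
    (fun K => (measurable_of_countable _).aestronglyMeasurable) hD
    (fun K => Eventually.of_forall fun k => ?_) (Eventually.of_forall fun k => ?_)
  · have h0 : 0 ≤ truncatedSq K k := by rw [truncatedSq_apply]; split_ifs <;> positivity
    rw [Real.norm_of_nonneg h0]
    exact truncatedSq_le K k
  · refine tendsto_const_nhds.congr' ?_
    filter_upwards [eventually_ge_atTop k] with K hK
    rw [truncatedSq_apply, if_pos hK]

/-- The maximal degree is of smaller order than the square root of the number of vertices. -/
theorem IsRegular.tendsto_maxDegree_sq_div (hd : IsRegular d D) :
    Tendsto (fun n => (maxDegree (d n) : ℝ) ^ 2 / n) atTop (𝓝 0) := by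
  rw [Metric.tendsto_atTop']
  intro δ hδ
  obtain ⟨K, hK⟩ := ((tendsto_integral_truncatedSq hd.integrable_sq).eventually_const_lt
    (sub_lt_self _ hδ)).exists
  -- The truncated square is a bounded test function, so the second moment of `D_n` above `K`
  -- converges to that of `D`, which is below `δ`. A maximal degree above `K` contributes its whole
  -- square to this tail; one below `K` gives at most `K ^ 2 / n`.
  have htail := hd.tendsto_sum_sq_div.sub (hd.tendsto_dist (truncatedSq K))
  have h1 := htail.eventually_lt_const (u := δ) (by linarith)
  have h2 : ∀ᶠ n : ℕ in atTop, (K : ℝ) ^ 2 / n < δ :=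
    (tendsto_const_div_atTop_nhds_zero_nat _).eventually_lt_const hδ
  obtain ⟨n₀, hn₀⟩ := eventually_atTop.1 (h1.and (h2.and (eventually_gt_atTop 0)))
  refine ⟨n₀, fun n hn => ?_⟩
  obtain ⟨h1, h2, hn0⟩ := hn₀ n hn.le
  have hn0' : (0 : ℝ) < n := by exact_mod_cast hn0
  rw [integral_degreeDistribution, ← sub_div, ← Finset.sum_sub_distrib] at h1
  rw [Real.dist_eq, sub_zero, abs_of_nonneg (by positivity)]
  have hne : (Finset.univ : Finset (Fin n)).Nonempty := ⟨⟨0, hn0⟩, Finset.mem_univ _⟩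
  obtain ⟨v, -, hv⟩ := Finset.exists_mem_eq_sup _ hne (d n)
  rw [maxDegree, hv]
  by_cases hvK : d n v ≤ K
  · refine lt_of_le_of_lt ?_ h2
    gcongr
  · refine lt_of_le_of_lt ?_ h1
    gcongr
    have hs := Finset.single_le_sum
      (f := fun v => (d n v : ℝ) ^ 2 - truncatedSq K (d n v))
      (fun u _ => sub_nonneg.2 (truncatedSq_le K (d n u))) (Finset.mem_univ v)
    simpa [truncatedSq_apply, hvK] using hs

theorem IsRegular.nu_eq [IsProbabilityMeasure D] (hd : IsRegular d D) :
    nu D = (∫ k, (k : ℝ) ^ 2 ∂D - ∫ k, (k : ℝ) ∂D) / ∫ k, (k : ℝ) ∂D := by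
  rw [nu, ← integral_sub hd.integrable_sq hd.integrable_id]
  congr 2
  funext k
  ring

/-- Mean zero concentrates `D` at `0`, and `degree_ne` then forbids every positive degree. This
settles the case in which `N` need not grow linearly and `ν` is a quotient by zero. -/
theorem IsRegular.eq_zero_of_integral_eq_zero [IsProbabilityMeasure D] (hd : IsRegular d D)
    (h : ∫ k, (k : ℝ) ∂D = 0) (n : ℕ) (v : Fin n) : d n v = 0 := by
  have hae := (integral_eq_zero_iff_of_nonneg (fun k : ℕ => Nat.cast_nonneg k)
    hd.integrable_id).1 h
  by_contra hv
  refine hd.degree_ne (d n v) (measure_mono_null ?_ (ae_iff.1 hae)) n v rfl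
  rintro k rfl
  simpa using hv

theorem not_hasComponentWithTwoCycles_of_eq_zero {n : ℕ} {d : Fin n → ℕ} (hd : ∀ v, d v = 0)
    (M : Configuration d) : ¬ HasComponentWithTwoCycles (underlyingMultigraph M) := by
  intro h
  obtain ⟨l, -, hl, -⟩ := h.exists_isClosedTrail
  exact absurd (hd (l.head hl).1.1) (Nat.ne_zero_of_lt (l.head hl).1.2.isLt)

theorem IsRegular.tendsto_configurationLaw_hasComponentWithTwoCycles [IsProbabilityMeasure D]
    (hd : IsRegular d D) (hν : nu D < 1) :
    Tendsto (fun n => configurationLaw (d n)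
      {M | HasComponentWithTwoCycles (underlyingMultigraph M)}) atTop (𝓝 0) := by
  set μ : ℝ := ∫ k, (k : ℝ) ∂D with hμ
  have hμ0 : 0 ≤ μ := integral_nonneg fun k => Nat.cast_nonneg k
  rcases hμ0.eq_or_lt with h0 | hpos
  · refine tendsto_const_nhds.congr fun n => ?_
    have : {M : Configuration (d n) | HasComponentWithTwoCycles (underlyingMultigraph M)} = ∅ :=
      Set.eq_empty_iff_forall_notMem.2
        (not_hasComponentWithTwoCycles_of_eq_zero (hd.eq_zero_of_integral_eq_zero h0.symm n))
    rw [this, measure_empty]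
  set N : ℕ → ℝ := fun n => ∑ v, (d n v : ℝ) with hN
  set S : ℕ → ℝ := fun n => ∑ v, ((d n v : ℝ) ^ 2 - d n v) with hS
  have hNn : Tendsto (fun n => N n / n) atTop (𝓝 μ) := hd.tendsto_sum_div
  have hNtop : Tendsto N atTop atTop := by
    refine (hNn.pos_mul_atTop hpos tendsto_natCast_atTop_atTop).congr' ?_
    filter_upwards [eventually_gt_atTop 0] with n hn
    have : (n : ℝ) ≠ 0 := by positivity
    field_simp
  have hSN : Tendsto (fun n => S n / N n) atTop (𝓝 (nu D)) := by
    rw [hd.nu_eq]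
    refine ((hd.tendsto_sum_sq_div.sub hd.tendsto_sum_div).div hNn hpos.ne').congr' ?_
    filter_upwards [eventually_gt_atTop 0] with n hn
    have : (n : ℝ) ≠ 0 := by positivity
    rw [Pi.div_apply, ← sub_div, ← Finset.sum_sub_distrib, div_div_div_cancel_right₀ this]
  have hΔ : Tendsto (fun n => (maxDegree (d n) : ℝ) ^ 2 / N n) atTop (𝓝 0) := by
    have := hd.tendsto_maxDegree_sq_div.div hNn hpos.ne'
    rw [zero_div] at this
    refine this.congr' ?_
    filter_upwards [eventually_gt_atTop 0] with n hn
    have : (n : ℝ) ≠ 0 := by positivity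
    rw [Pi.div_apply, div_div_div_cancel_right₀ this]
  -- The maximum with `0` secures `0 ≤ ρ` without a separate proof that `ν` is non-negative.
  obtain ⟨ρ, hρν, hρ1⟩ := exists_between (max_lt hν one_pos)
  have hρ0 : 0 ≤ ρ := (le_max_right _ _).trans hρν.le
  have hSρ : ∀ᶠ n in atTop, S n ≤ ρ * N n := by
    filter_upwards [hSN.eventually_lt_const ((le_max_left _ _).trans_lt hρν),
      hNtop.eventually_gt_atTop 0] with n h1 h2
    exact ((div_lt_iff₀ h2).1 h1).le
  obtain ⟨ε, hε0, hε1⟩ := exists_between (sub_pos.2 hρ1)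
  have hS0 : ∀ n, 0 ≤ S n := fun n => Finset.sum_nonneg fun v _ => sub_nonneg.2 (by
    exact_mod_cast Nat.le_self_pow two_ne_zero (d n v))
  have hbound := ENNReal.tendsto_ofReal
    (tendsto_trailBound (Δ := fun n => (maxDegree (d n) : ℝ)) hρ0 hε0 (by linarith) hS0 hSρ
      hNtop hΔ)
  rw [ENNReal.ofReal_zero] at hbound
  refine tendsto_of_tendsto_of_tendsto_of_le_of_le' tendsto_const_nhds hbound
    (Eventually.of_forall fun n => zero_le) ?_
  filter_upwards [hNtop.eventually_gt_atTop 0] with n hn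
  have := (hd.feasible n).nonempty_configuration
  refine configurationLaw_hasComponentWithTwoCycles_le
    (fun v => Finset.le_sup (Finset.mem_univ v)) (mul_pos (by linarith) hn) ?_
  -- `2 * L ≤ ε * N` is exactly what leaves room for `q = (1 - ε) * N`.
  have := Nat.floor_le (a := ε * N n / 2) (by positivity)
  change (1 - ε) * N n + 2 * _ ≤ N n
  linarith

end Regular

end ConfigModel

theorem mainTheorem12 (d : (n : ℕ) → Fin n → ℕ) (D : Measure ℕ) [IsProbabilityMeasure D]
    (hd : ConfigModel.IsRegular d D) (hν : ConfigModel.nu D < 1) :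
    Tendsto
      (fun n => ConfigModel.configurationLaw (d n)
        {M | ¬ ConfigModel.HasComponentWithTwoCycles (ConfigModel.underlyingMultigraph M)})
      atTop (𝓝 1) := by
  have h := ENNReal.Tendsto.sub (tendsto_const_nhds (x := (1 : ENNReal)))
    (hd.tendsto_configurationLaw_hasComponentWithTwoCycles hν) (Or.inl ENNReal.one_ne_top)
  rw [tsub_zero] at h
  refine h.congr fun n => ?_
  have := (hd.feasible n).nonempty_configuration
  have := ConfigModel.isProbabilityMeasure_configurationLaw (d := d n)
  rw [← prob_compl_eq_one_sub (Set.toFinite _).measurableSet]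
  rfl
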